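/- Let $\Lambda$ be a discrete valuation ring with maximal ideal $(p)$. An embedding is a pair $(A\subset B)$ with $B$ a finite length $\Lambda$-module and $A$ a submodule; $E_{(n)}$ denotes $(0\subset \Lambda/(p^n))$. If $r$ is the least integer with $p^rA=0$, the tableau of $(A\subset B)$ is $[\gamma^{(0)},\dots,\gamma^{(r)}]$, where $\gamma^{(i)}$ is the partition listing the lengths of the indecomposable summands of $B/p^iA$. A finite strictly increasing sequence $m=(m_0<\dots<m_{N-1})$ in $\mathbb N_0$ has a gap after $m_i$ if $i=N-1$ or $m_{i+1}>m_i+1$. For a set $I$ of indices put $P(m,I)=\big((a)\subset\bigoplus_{i\in I}\Lambda/(p^{m_i+1})\big)$ with $a=\sum_{i\in I}p^{m_i-i}b_i$, where $b_i$ generates the summand of order $p^{m_i+1}$. If $I$ is the set of $i$ such that $m$ has a gap after $m_i$, this is the pole $P(m)$; adding one further index gives an extended pole. Consider an increasing box move which replaces the columns $C(e,f)_n$, $C(e',f')_{n'}$ (of lengths $n,n'$, with entries $e,\dots,f$ and $e',\dots,f'$ at the bottom) by $C(e,f)_{n'}$, $C(e',f')_{n}$, where $n>n'$, $1\le e\le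 f$, $e<e'$ and $f-e=f'-e'$. Let $m,\widetilde m$ be finite strictly increasing sequences of the same length $N\ge f$, and $m',\widetilde m'$ of the same length $N'\ge f'$, such that $$m_{x-1}=n-f+x-1,\quad \widetilde m_{x-1}=n'-f+x-1\qquad(e\le x\le f),$$ $$m'_{x-1}=n'-f'+x-1,\quad \widetilde m'_{x-1}=n-f'+x-1\qquad(e'\le x\le f'),$$ and $\widetilde m_i=m_i$, $\widetilde m'_i=m'_i$ for all other indices $i$. Let $I$ consist of $f-1$ and the indices of the gaps of $m$ (equivalently, of the gaps of $\widetilde m$, and $e-2$ if $e\ge2$), and let $I'$ consist of $f'-1$ and the indices of the gaps of $\widetilde m'$ (equivalently, $e'-2$ and the gaps of $m'$). Put $$R=P(m,I)=((a)\subset B),\quad \widetilde R=P(\widetilde m,I),\quad R'=P(m',I')=((c)\subset D),\quad \widetilde R'=P(\widetilde m',I').$$ Write $b_n$, $\widetilde d_n$ for the generators with index $f-1$, $f'-1$, of order $p^n$, of the ambient spaces of $R$ and $\widetilde R'$, and $d_{n'}$ for the generator with index $f'-1$, of order $p^{n'}$, of $D$. The maps $\widetilde R\to R$ and $R'\to\widetilde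 R'$ which send the generator with index $f-1$ to $p^{n-n'}b_n$, respectively the generator $d_{n'}$ to $p^{n-n'}\widetilde d_n$, and every other generator to the generator with the same index, are monomorphisms of embeddings with cokernel $E_{(n-n')}$; the cokernel maps send $b_n$, respectively $\widetilde d_n$, to $1$ and the other generators to $0$. The pullback of $R\to E_{(n-n')}\leftarrow\widetilde R'$ is isomorphic to the embedding $$Q=\big((r,s)\subset B\oplus D\big),\qquad r=(a,\,p^{n'-f}d_{n'}),\quad s=(0,c),$$ and $Q$ has the same tableau as $R\oplus R'=\big((a)\oplus(c)\subset B\oplus D\big)$. -/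

import Mathlib

universe u v

/-! ### Partition types and tableaux of embeddings -/

/-- A partition: a weakly decreasing list of positive integers. -/
def IsPartition (l : List ℕ) : Prop :=
  l.Pairwise (· ≥ ·) ∧ ∀ x ∈ l, 0 < x

/-- The cyclic module `Λ / (p ^ n)`. -/
abbrev Cyc {Λ : Type u} [CommRing Λ] (p : Λ) (n : ℕ) : Type u :=
  Λ ⧸ Ideal.span {p ^ n}

/-- The module `V` has type `l`, i.e. `l` is the partition which lists the lengths of the
indecomposable (= cyclic) direct summands of `V`: `V ≅ ⨁ i, Λ / (p ^ l_i)`. -/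
def HasType {Λ : Type u} [CommRing Λ] (p : Λ) (V : Type v) [AddCommGroup V] [Module Λ V]
    (l : List ℕ) : Prop :=
  IsPartition l ∧ Nonempty (V ≃ₗ[Λ] ((i : Fin l.length) → Cyc p l[i]))

/-- The embedding `(U ⊂ V)` has tableau `Γ = [γ⁽⁰⁾, …, γ⁽ʳ⁾]`: here `r` is the Loewy length of `U`
(the least `r` with `p ^ r U = 0`) and `γ⁽ⁱ⁾` is the type of `V / p ^ i U`. -/
def HasTableau {Λ : Type u} [CommRing Λ] (p : Λ) {V : Type v} [AddCommGroup V] [Module Λ V]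
    (U : Submodule Λ V) (Γ : List (List ℕ)) : Prop :=
  ∃ r : ℕ, IsLeast {j : ℕ | Ideal.span {p ^ j} • U = ⊥} r ∧ Γ.length = r + 1 ∧
    ∀ (i : ℕ) (hi : i < Γ.length), HasType p (V ⧸ (Ideal.span {p ^ i} • U)) Γ[i]

/-- Componentwise short exact sequence of embeddings
`0 → (A₁ ⊂ V₁) → (A₂ ⊂ V₂) → (A₃ ⊂ V₃) → 0`. -/
structure IsShortExact {Λ : Type u} [CommRing Λ] {V₁ V₂ V₃ : Type v}
    [AddCommGroup V₁] [Module Λ V₁] [AddCommGroup V₂] [Module Λ V₂] [AddCommGroup V₃] [Module Λ V₃]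
    (A₁ : Submodule Λ V₁) (A₂ : Submodule Λ V₂) (A₃ : Submodule Λ V₃)
    (ι : V₁ →ₗ[Λ] V₂) (π : V₂ →ₗ[Λ] V₃) : Prop where
  injective : Function.Injective ι
  exact : LinearMap.range ι = LinearMap.ker π
  surjective : Function.Surjective π
  exact_sub : A₁.map ι = A₂ ⊓ LinearMap.ker π
  surjective_sub : A₂.map π = A₃

/-! ### Poles and extended poles -/

/-- The indices `i` such that the finite sequence `m 0 < m 1 < ⋯ < m (N - 1)` has a gap after
`m i`. -/
def gaps (N : ℕ) (m : ℕ → ℕ) : Finset ℕ :=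
  (Finset.range N).filter fun i => i + 1 = N ∨ m i + 1 < m (i + 1)

/-- The module `⨁ i ∈ I, Λ / (p ^ (m i + 1))`. -/
abbrev Ambient {Λ : Type u} [CommRing Λ] (p : Λ) (m : ℕ → ℕ) (I : Finset ℕ) : Type u :=
  (i : I) → Cyc p (m i + 1)

/-- The generator of order `p ^ (m i + 1)` of the summand with index `i`. -/
def basisElt {Λ : Type u} [CommRing Λ] (p : Λ) (m : ℕ → ℕ) (I : Finset ℕ) (i : I) :
    Ambient p m I :=
  Pi.single i (Ideal.Quotient.mk _ 1)

/-- The element `∑ i ∈ I, p ^ (m i - i) b_i`. -/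
def poleGen {Λ : Type u} [CommRing Λ] (p : Λ) (m : ℕ → ℕ) (I : Finset ℕ) : Ambient p m I :=
  ∑ i : I, p ^ (m i - i) • basisElt p m I i

/-- The cyclic embedding `((∑ i ∈ I, p ^ (m i - i) b_i) ⊂ ⨁ i ∈ I, Λ / (p ^ (m i + 1)))`.
For `I = gaps N m` this is the pole `P((m_i))`; for `I = insert x (gaps N m)`
with `x < N` it is the extended pole `P((m_i) ∨ m_x)` if there is no gap after `m_x`, and again
the pole `P((m_i))` if there is one. -/
def pole {Λ : Type u} [CommRing Λ] (p : Λ) (m : ℕ → ℕ) (I : Finset ℕ) :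
    Submodule Λ (Ambient p m I) :=
  Submodule.span Λ {poleGen p m I}

/-- The canonical map `Λ / (p ^ x) → Λ / (p ^ y)`: multiplication by `p ^ (y - x)` if `x ≤ y`,
and the projection if `y ≤ x`. -/
def cycMap {Λ : Type u} [CommRing Λ] (p : Λ) (x y : ℕ) : Cyc p x →ₗ[Λ] Cyc p y :=
  Submodule.mapQ _ _ (LinearMap.mulLeft Λ (p ^ (y - x))) (by
    rw [Ideal.span_le, Set.singleton_subset_iff]
    change p ^ (y - x) * p ^ x ∈ Ideal.span {p ^ y}
    rw [← pow_add, Ideal.mem_span_singleton]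
    exact pow_dvd_pow p (by omega))

/-- The direct sum of the canonical maps `Λ / (p ^ (m₁ i + 1)) → Λ / (p ^ (m₂ i + 1))`. -/
def ambientMap {Λ : Type u} [CommRing Λ] (p : Λ) (m₁ m₂ : ℕ → ℕ) (I : Finset ℕ) :
    Ambient p m₁ I →ₗ[Λ] Ambient p m₂ I :=
  LinearMap.pi fun i => cycMap p (m₁ i + 1) (m₂ i + 1) ∘ₗ LinearMap.proj i

/-! ### Increasing box moves -/

/-- The combinatorial data of an increasing box move which replaces the columns `C(e,f)_n`,
`C(e',f')_{n'}` of a tableau `Γ` by `C(e,f)_{n'}`, `C(e',f')_n`, together with the height sequences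
of the poles `P`, `P'` for `Γ` and `P~`, `P~'` for the new tableau which contain these columns.
The finite parts of the height sequences are `m i`, `mt i` for `i < N` and
`m' i`, `mt' i` for `i < N'`. The entry `x` of the tableau of a pole with height sequence `m`
lies in row `m (x - 1) + 1`. -/
structure BoxMove where
  (n n' e f e' f' N N' : ℕ)
  (m m' mt mt' : ℕ → ℕ)
  n_lt : n' < n
  e_pos : 1 ≤ e
  e_le_f : e ≤ f
  e_lt : e < e'
  /-- the two columns have the same number of entries: `f - e = f' - e'` -/
  same_height : f + e' = f' + e
  f_le : f ≤ N
  f_le' : f' ≤ N'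
  strictMono_m : StrictMonoOn m (Set.Iio N)
  strictMono_m' : StrictMonoOn m' (Set.Iio N')
  strictMono_mt : StrictMonoOn mt (Set.Iio N)
  strictMono_mt' : StrictMonoOn mt' (Set.Iio N')
  /-- the entry `x ∈ {e, …, f}` lies in row `n - f + x` -/
  col_m : ∀ x, e ≤ x → x ≤ f → m (x - 1) + 1 + f = n + x
  /-- the entry `x ∈ {e', …, f'}` lies in row `n' - f' + x` -/
  col_m' : ∀ x, e' ≤ x → x ≤ f' → m' (x - 1) + 1 + f' = n' + x
  /-- the entry `x ∈ {e, …, f}` lies in row `n' - f + x` -/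
  col_mt : ∀ x, e ≤ x → x ≤ f → mt (x - 1) + 1 + f = n' + x
  /-- the entry `x ∈ {e', …, f'}` lies in row `n - f' + x` -/
  col_mt' : ∀ x, e' ≤ x → x ≤ f' → mt' (x - 1) + 1 + f' = n + x
  mt_eq : ∀ i < N, ¬ (e - 1 ≤ i ∧ i ≤ f - 1) → mt i = m i
  mt_eq' : ∀ i < N', ¬ (e' - 1 ≤ i ∧ i ≤ f' - 1) → mt' i = m' i

namespace BoxMove

/-- The index set of the generators of the ambient spaces of `R` and `R~`. -/
def I (X : BoxMove) : Finset ℕ := insert (X.f - 1) (gaps X.N X.m)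

/-- The index set of the generators of the ambient spaces of `R'` and `R~'`. -/
def I' (X : BoxMove) : Finset ℕ := insert (X.f' - 1) (gaps X.N' X.mt')

/-- The index of the part `n` of the ambient space of `R`. -/
def idx (X : BoxMove) : X.I := ⟨X.f - 1, Finset.mem_insert_self _ _⟩

/-- The index of the part `n` of the ambient space of `R~'` and of the part `n'` of that of
`R'`. -/
def idx' (X : BoxMove) : X.I' := ⟨X.f' - 1, Finset.mem_insert_self _ _⟩

/-- `R~`, which has the generators indexed by `I`, is the pole `P((mt_i))`, extended at
`mt_{e-2}` if `e ≥ 2`. -/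
theorem I_eq (X : BoxMove) :
    X.I = if 2 ≤ X.e then insert (X.e - 2) (gaps X.N X.mt) else gaps X.N X.mt := by
  have hn := X.n_lt
  have he := X.e_pos
  have hef := X.e_le_f
  have hfN := X.f_le
  have hlow : 2 ≤ X.e → X.mt (X.e - 2) < X.mt (X.e - 1) := fun h =>
    X.strictMono_mt (Set.mem_Iio.2 (by omega)) (Set.mem_Iio.2 (by omega)) (by omega)
  have hup : X.f < X.N → X.m (X.f - 1) < X.m X.f := fun h =>
    X.strictMono_m (Set.mem_Iio.2 (by omega)) (Set.mem_Iio.2 (by omega)) (by omega)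
  have c1 := X.col_m X.e le_rfl hef
  have c2 := X.col_mt X.e le_rfl hef
  have c3 := X.col_m X.f hef le_rfl
  have c4 := X.col_mt X.f hef le_rfl
  ext i
  have hI : i ∈ (if 2 ≤ X.e then insert (X.e - 2) (gaps X.N X.mt) else gaps X.N X.mt) ↔
      (2 ≤ X.e ∧ i = X.e - 2) ∨ i ∈ gaps X.N X.mt := by
    split_ifs with h <;> simp [h]
  rw [hI]
  simp only [I, gaps, Finset.mem_insert, Finset.mem_filter, Finset.mem_range]
  by_cases h1 : i = X.f - 1
  · subst h1
    refine iff_of_true (Or.inl rfl) (Or.inr ⟨by omega, ?_⟩)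
    by_cases h2 : X.f = X.N
    · left; omega
    · right
      have e1 := X.mt_eq X.f (by omega) (by omega)
      have e2 := hup (by omega)
      rw [show X.f - 1 + 1 = X.f by omega]
      omega
  by_cases h3 : 2 ≤ X.e ∧ i = X.e - 2
  · obtain ⟨h3, rfl⟩ := h3
    refine iff_of_true (Or.inr ⟨by omega, Or.inr ?_⟩) (Or.inl ⟨h3, rfl⟩)
    have e1 := X.mt_eq (X.e - 2) (by omega) (by omega)
    have e2 := hlow h3
    rw [show X.e - 2 + 1 = X.e - 1 by omega]
    omega
  simp only [h1, h3, false_or]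
  refine and_congr_right fun hi => ?_
  by_cases h4 : i + 1 = X.N
  · simp [h4]
  simp only [h4, false_or]
  by_cases h5 : X.e - 1 ≤ i ∧ i ≤ X.f - 1
  · have d1 := X.col_m (i + 1) (by omega) (by omega)
    have d2 := X.col_mt (i + 1) (by omega) (by omega)
    have d3 := X.col_m (i + 1 + 1) (by omega) (by omega)
    have d4 := X.col_mt (i + 1 + 1) (by omega) (by omega)
    simp only [Nat.add_sub_cancel] at d1 d2 d3 d4
    omega
  · have d1 := X.mt_eq i hi h5
    have d2 := X.mt_eq (i + 1) (by omega) (by omega)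
    omega

/-- `R'`, which has the generators indexed by `I'`, is the pole `P((m'_i))`, extended at
`m'_{e'-2}` (note that `e' ≥ 2`). -/
theorem I'_eq (X : BoxMove) : X.I' = insert (X.e' - 2) (gaps X.N' X.m') := by
  have hn := X.n_lt
  have he := X.e_pos
  have he' := X.e_lt
  have hef := X.e_le_f
  have hh := X.same_height
  have hfN := X.f_le'
  have hlow : X.m' (X.e' - 2) < X.m' (X.e' - 1) :=
    X.strictMono_m' (Set.mem_Iio.2 (by omega)) (Set.mem_Iio.2 (by omega)) (by omega)
  have hup : X.f' < X.N' → X.mt' (X.f' - 1) < X.mt' X.f' := fun h =>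
    X.strictMono_mt' (Set.mem_Iio.2 (by omega)) (Set.mem_Iio.2 (by omega)) (by omega)
  have c1 := X.col_m' X.e' le_rfl (by omega)
  have c2 := X.col_mt' X.e' le_rfl (by omega)
  have c3 := X.col_m' X.f' (by omega) le_rfl
  have c4 := X.col_mt' X.f' (by omega) le_rfl
  ext i
  simp only [I', gaps, Finset.mem_insert, Finset.mem_filter, Finset.mem_range]
  by_cases h1 : i = X.f' - 1
  · subst h1
    refine iff_of_true (Or.inl rfl) (Or.inr ⟨by omega, ?_⟩)
    by_cases h2 : X.f' = X.N'
    · left; omega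
    · right
      have e1 := X.mt_eq' X.f' (by omega) (by omega)
      have e2 := hup (by omega)
      rw [show X.f' - 1 + 1 = X.f' by omega]
      omega
  by_cases h3 : i = X.e' - 2
  · subst h3
    refine iff_of_true (Or.inr ⟨by omega, Or.inr ?_⟩) (Or.inl rfl)
    have e1 := X.mt_eq' (X.e' - 2) (by omega) (by omega)
    rw [show X.e' - 2 + 1 = X.e' - 1 by omega]
    omega
  simp only [h1, h3, false_or]
  refine and_congr_right fun hi => ?_
  by_cases h4 : i + 1 = X.N'
  · simp [h4]
  simp only [h4, false_or]
  by_cases h5 : X.e' - 1 ≤ i ∧ i ≤ X.f' - 1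
  · have d1 := X.col_m' (i + 1) (by omega) (by omega)
    have d2 := X.col_mt' (i + 1) (by omega) (by omega)
    have d3 := X.col_m' (i + 1 + 1) (by omega) (by omega)
    have d4 := X.col_mt' (i + 1 + 1) (by omega) (by omega)
    simp only [Nat.add_sub_cancel] at d1 d2 d3 d4
    omega
  · have d1 := X.mt_eq' i hi h5
    have d2 := X.mt_eq' (i + 1) (by omega) (by omega)
    omega

variable {Λ : Type u} [CommRing Λ]

/-- The embedding `R = ((a) ⊂ B)`, `B = Ambient p X.m X.I`. -/
def R (X : BoxMove) (p : Λ) : Submodule Λ (Ambient p X.m X.I) := pole p X.m X.I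

/-- The embedding `R' = ((c) ⊂ D)`, `D = Ambient p X.m' X.I'`. -/
def R' (X : BoxMove) (p : Λ) : Submodule Λ (Ambient p X.m' X.I') := pole p X.m' X.I'

/-- The embedding `R~`. -/
def Rt (X : BoxMove) (p : Λ) : Submodule Λ (Ambient p X.mt X.I) := pole p X.mt X.I

/-- The embedding `R~'`. -/
def Rt' (X : BoxMove) (p : Λ) : Submodule Λ (Ambient p X.mt' X.I') := pole p X.mt' X.I'

/-- The monomorphism `R~ → R`, `b~_{n'} ↦ p ^ (n - n') b_n`, and `b~_i ↦ b_i` otherwise. -/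
def mono (X : BoxMove) (p : Λ) : Ambient p X.mt X.I →ₗ[Λ] Ambient p X.m X.I :=
  ambientMap p X.mt X.m X.I

/-- The monomorphism `R' → R~'`, `d_{n'} ↦ p ^ (n - n') d~_n`, and `d_i ↦ d~_i` otherwise. -/
def mono' (X : BoxMove) (p : Λ) : Ambient p X.m' X.I' →ₗ[Λ] Ambient p X.mt' X.I' :=
  ambientMap p X.m' X.mt' X.I'

/-- The cokernel map `R → E_{(n-n')}` of `R~ → R`: `b_n ↦ 1`, and `b_i ↦ 0` otherwise. -/
def coker (X : BoxMove) (p : Λ) : Ambient p X.m X.I →ₗ[Λ] Cyc p (X.n - X.n') :=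
  cycMap p (X.m X.idx + 1) (X.n - X.n') ∘ₗ LinearMap.proj X.idx

/-- The cokernel map `R~' → E_{(n-n')}` of `R' → R~'`: `d~_n ↦ 1`, and `d~_i ↦ 0` otherwise. -/
def coker' (X : BoxMove) (p : Λ) : Ambient p X.mt' X.I' →ₗ[Λ] Cyc p (X.n - X.n') :=
  cycMap p (X.mt' X.idx' + 1) (X.n - X.n') ∘ₗ LinearMap.proj X.idx'

/-- The ambient space of the pullback of `R → E_{(n-n')} ← R~'`. -/
def pullbackAmbient (X : BoxMove) (p : Λ) :
    Submodule Λ (Ambient p X.m X.I × Ambient p X.mt' X.I') :=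
  LinearMap.eqLocus (X.coker p ∘ₗ LinearMap.fst Λ _ _) (X.coker' p ∘ₗ LinearMap.snd Λ _ _)

/-- The pullback of `R → E_{(n-n')} ← R~'`, as a submodule of its ambient space (the submodule part
of `E_{(n-n')} = (0 ⊂ Λ / (p ^ (n - n')))` is zero). -/
def pullbackEmb (X : BoxMove) (p : Λ) : Submodule Λ (X.pullbackAmbient p) :=
  ((X.R p).prod (X.Rt' p)).comap (X.pullbackAmbient p).subtype

/-- The submodule generator `r = (a, p ^ (n' - f) d_{n'})`. -/
def r (X : BoxMove) (p : Λ) : Ambient p X.m X.I × Ambient p X.m' X.I' :=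
  (poleGen p X.m X.I, p ^ (X.n' - X.f) • basisElt p X.m' X.I' X.idx')

/-- The submodule generator `s = (0, c)`. -/
def s (X : BoxMove) (p : Λ) : Ambient p X.m X.I × Ambient p X.m' X.I' :=
  (0, poleGen p X.m' X.I')

/-- The embedding `Q = ((r, s) ⊂ B ⊕ D)`. -/
def Q (X : BoxMove) (p : Λ) : Submodule Λ (Ambient p X.m X.I × Ambient p X.m' X.I') :=
  Submodule.span Λ {X.r p, X.s p}

end BoxMove

/-! Pullback. The map `overlap` $\sigma : B \to \widetilde D$, $b_n \mapsto \widetilde d_n$, other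
generators to $0$, lifts the cokernel map of $R$ through that of $\widetilde R'$. With $\iota$ =
`mono'`, the map $(x, y) \mapsto (x, \sigma x - \iota y)$ is therefore an isomorphism from $B \oplus
D$ onto the pullback of the ambient spaces (`exists_equiv_eqLocus`). Since $\sigma a =
p^{n-f}\widetilde d_n = \iota(p^{n'-f} d_{n'})$, it sends $r$ to $(a, 0)$ and $s$ to $(0,
-\widetilde c)$, where $\widetilde c = \iota c$ generates $\widetilde R'$. These two elements
generate the pullback embedding.

Tableau. It suffices to compare the quotients by $p^iQ$ and $p^i(R \oplus R')$ for each $i$. The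
generators differ only by the component $p^{i+n'-f} d_{n'}$. A homomorphism $h : B \to D/(p^i c)$
with $h(p^i a) = p^{i+n'-f} d_{n'}$ removes it by the shear $(x, y) \mapsto (x, y + h x)$
(`nonempty_pairQuotient_equiv`).

Such an $h$ comes from the identity $p^{n'-f'+e'-1} d_{n'} - p^{n-f'+e'-1} z = p^{e'-1} c$
(`exists_pow_smul_poleGen_eq`): modulo $p^i c$ a large multiple of $d_{n'}$ is divisible by a higher
power of $p$, so $b_n$ can be sent to $z$. If $i \le e - 2$, the error is absorbed by the generator
with index $e-2$, which belongs to $I$ exactly for this purpose (`exists_lift_pow_smul_poleGen`). -/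

/-! ### Cyclic modules and coordinates of pole generators -/

section Cyclic

variable {Λ : Type u} [CommRing Λ]

theorem Cyc.mk_pow_eq_zero {p : Λ} {k n : ℕ} (h : n ≤ k) :
    (Ideal.Quotient.mk (Ideal.span {p ^ n}) (p ^ k)) = 0 :=
  Ideal.Quotient.eq_zero_iff_mem.2 (Ideal.mem_span_singleton.2 (pow_dvd_pow p h))

theorem Cyc.mk_pow_eq_zero_iff [IsDomain Λ] {p : Λ} (hp : Irreducible p) {k n : ℕ} :
    (Ideal.Quotient.mk (Ideal.span {p ^ n}) (p ^ k)) = 0 ↔ n ≤ k := by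
  rw [Ideal.Quotient.eq_zero_iff_mem, Ideal.mem_span_singleton,
    pow_dvd_pow_iff hp.ne_zero hp.not_isUnit]

theorem Cyc.smul_mk (p a x : Λ) (n : ℕ) :
    a • (Ideal.Quotient.mk (Ideal.span {p ^ n}) x : Cyc p n) = Ideal.Quotient.mk _ (a * x) := rfl

theorem cycMap_mk (p : Λ) (x y : ℕ) (t : Λ) :
    cycMap p x y (Ideal.Quotient.mk _ t) = Ideal.Quotient.mk _ (p ^ (y - x) * t) := rfl

/-- The map `Λ / (p ^ n) → M` which sends `1` to an element annihilated by `p ^ n`. -/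
def cycLift {M : Type v} [AddCommGroup M] [Module Λ M] (p : Λ) (n : ℕ) (w : M)
    (h : p ^ n • w = 0) : Cyc p n →ₗ[Λ] M :=
  Submodule.liftQ _ (LinearMap.toSpanSingleton Λ M w) (by
    rw [Ideal.span_le, Set.singleton_subset_iff]
    simpa using h)

theorem cycLift_mk {M : Type v} [AddCommGroup M] [Module Λ M] (p : Λ) (n : ℕ) (w : M)
    (h : p ^ n • w = 0) (t : Λ) : cycLift p n w h (Ideal.Quotient.mk _ t) = t • w := rfl

theorem basisElt_apply_self (p : Λ) (m : ℕ → ℕ) (I : Finset ℕ) (i : I) :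
    basisElt p m I i i = Ideal.Quotient.mk _ 1 := by
  simp [basisElt]

theorem basisElt_apply_of_ne (p : Λ) (m : ℕ → ℕ) (I : Finset ℕ) {i j : I} (h : j ≠ i) :
    basisElt p m I i j = 0 := by
  simp [basisElt, h]

theorem poleGen_apply (p : Λ) (m : ℕ → ℕ) (I : Finset ℕ) (i : I) :
    poleGen p m I i = Ideal.Quotient.mk _ (p ^ (m i - i)) := by
  rw [poleGen, Finset.sum_apply, Finset.sum_eq_single i]
  · rw [Pi.smul_apply, basisElt_apply_self, Cyc.smul_mk, mul_one]
  · intro j _ hj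
    rw [Pi.smul_apply, basisElt_apply_of_ne p m I hj.symm, smul_zero]
  · simp

theorem ambientMap_apply (p : Λ) (m₁ m₂ : ℕ → ℕ) (I : Finset ℕ) (v : Ambient p m₁ I) (i : I) :
    ambientMap p m₁ m₂ I v i = cycMap p (m₁ i + 1) (m₂ i + 1) (v i) := rfl

theorem Ambient.exists_pow_smul_eq_zero (p : Λ) (m : ℕ → ℕ) (I : Finset ℕ) :
    ∃ k : ℕ, ∀ v : Ambient p m I, p ^ k • v = 0 := by
  refine ⟨∑ i ∈ I, (m i + 1), fun v => funext fun i => ?_⟩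
  obtain ⟨t, ht⟩ := Ideal.Quotient.mk_surjective (v i)
  have hle : m i + 1 ≤ ∑ j ∈ I, (m j + 1) :=
    Finset.single_le_sum (f := fun j => m j + 1) (fun _ _ => Nat.zero_le _) i.2
  rw [Pi.smul_apply, ← ht, Cyc.smul_mk, map_mul, Cyc.mk_pow_eq_zero hle, zero_mul, Pi.zero_apply]

end Cyclic

/-! ### Short exact sequences between poles that differ in one height -/

section ShortExact

variable {Λ : Type u} [CommRing Λ]

theorem ambientMap_poleGen (p : Λ) (m₁ m₂ : ℕ → ℕ) (I : Finset ℕ)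
    (h : ∀ i ∈ I, i ≤ m₁ i ∧ m₁ i ≤ m₂ i) :
    ambientMap p m₁ m₂ I (poleGen p m₁ I) = poleGen p m₂ I := by
  funext i
  have := h i i.2
  rw [ambientMap_apply, poleGen_apply, poleGen_apply, cycMap_mk, ← pow_add]
  congr 2
  omega

/-- This is why the cokernel embedding has zero submodule: the $k$-th coordinate of the generator is
$p^{m_k-k}$, which vanishes in $\Lambda/(p^l)$. -/
theorem pole_le_ker_cycMap_proj (p : Λ) (m : ℕ → ℕ) (I : Finset ℕ) (k : I) (l : ℕ)
    (hl : l ≤ m k - k) :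
    pole p m I ≤ LinearMap.ker (cycMap p (m k + 1) l ∘ₗ LinearMap.proj k) := by
  rw [pole, Submodule.span_singleton_le_iff_mem, LinearMap.mem_ker, LinearMap.comp_apply,
    LinearMap.proj_apply, poleGen_apply, cycMap_mk, ← pow_add]
  exact Cyc.mk_pow_eq_zero (by omega)

theorem isShortExact_ambientMap [IsDomain Λ] (p : Λ) (hp : Irreducible p) (m₁ m₂ : ℕ → ℕ)
    (I : Finset ℕ) (k : I) (l : ℕ) (hk : m₂ k = m₁ k + l)
    (hne : ∀ i ∈ I, i ≠ k → m₁ i = m₂ i) (hle : ∀ i ∈ I, i ≤ m₁ i) :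
    IsShortExact (pole p m₁ I) (pole p m₂ I) ⊥ (ambientMap p m₁ m₂ I)
      (cycMap p (m₂ k + 1) l ∘ₗ LinearMap.proj k) := by
  have hkle := hle k k.2
  have hker := pole_le_ker_cycMap_proj p m₂ I k l (by omega)
  have hmono : ∀ i ∈ I, m₁ i ≤ m₂ i := fun i hi => by
    by_cases h : i = k
    · rw [h]; omega
    · exact (hne i hi h).le
  refine ⟨?_, ?_, ?_, ?_, ?_⟩
  · rw [injective_iff_map_eq_zero]
    intro v hv
    funext i
    obtain ⟨t, ht⟩ := Ideal.Quotient.mk_surjective (v i)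
    have h1 := congrFun hv i
    have h2 := hmono i i.2
    rw [ambientMap_apply, ← ht, cycMap_mk, Pi.zero_apply, Ideal.Quotient.eq_zero_iff_mem,
      Ideal.mem_span_singleton,
      show m₂ i + 1 = (m₂ i + 1 - (m₁ i + 1)) + (m₁ i + 1) by omega, pow_add,
      Nat.add_sub_cancel] at h1
    rw [← ht, Pi.zero_apply, Ideal.Quotient.eq_zero_iff_mem, Ideal.mem_span_singleton]
    exact (mul_dvd_mul_iff_left (pow_ne_zero _ hp.ne_zero)).1 h1
  · apply le_antisymm
    · rintro _ ⟨v, rfl⟩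
      obtain ⟨t, ht⟩ := Ideal.Quotient.mk_surjective (v k)
      rw [LinearMap.mem_ker, LinearMap.comp_apply, LinearMap.proj_apply, ambientMap_apply, ← ht,
        cycMap_mk, cycMap_mk, ← mul_assoc, ← pow_add, map_mul, Cyc.mk_pow_eq_zero (by omega),
        zero_mul]
    · intro v hv
      -- Here $l \le m_2(k)$, so `cycMap` is the plain projection and membership in the kernel says
      -- that $p^l$ divides the $k$-th coordinate. The preimage has the quotient `t` there and the
      -- old coordinates elsewhere.
      choose g hg using fun i => Ideal.Quotient.mk_surjective (v i)
      rw [LinearMap.mem_ker, LinearMap.comp_apply, LinearMap.proj_apply, ← hg, cycMap_mk,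
        show l - (m₂ k + 1) = 0 by omega, pow_zero, one_mul, Ideal.Quotient.eq_zero_iff_mem,
        Ideal.mem_span_singleton] at hv
      obtain ⟨t, ht⟩ := hv
      refine ⟨fun i => Ideal.Quotient.mk _ (if i = k then t else g i), funext fun i => ?_⟩
      rw [ambientMap_apply, cycMap_mk, ← hg i]
      by_cases h : i = k
      · subst h
        rw [if_pos rfl, ht]
        congr 3
        omega
      · rw [if_neg h, ← hne i i.2 (fun h' => h (Subtype.ext h')), Nat.sub_self, pow_zero, one_mul]
  · intro y
    obtain ⟨t, rfl⟩ := Ideal.Quotient.mk_surjective y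
    refine ⟨Pi.single k (Ideal.Quotient.mk _ t), ?_⟩
    rw [LinearMap.comp_apply, LinearMap.proj_apply, Pi.single_eq_same, cycMap_mk,
      show l - (m₂ k + 1) = 0 by omega, pow_zero, one_mul]
  · rw [inf_eq_left.2 hker, pole, pole, Submodule.map_span, Set.image_singleton,
      ambientMap_poleGen p m₁ m₂ I fun i hi => ⟨hle i hi, hmono i hi⟩]
  · exact (LinearMap.le_ker_iff_map).1 hker

end ShortExact

/-! ### Existence of types and tableaux -/

section Types

variable {Λ : Type u} [CommRing Λ]

theorem HasType.of_equiv {p : Λ} {V W : Type*} [AddCommGroup V] [Module Λ V]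
    [AddCommGroup W] [Module Λ W] {l : List ℕ} (h : HasType p V l) (e : W ≃ₗ[Λ] V) :
    HasType p W l :=
  ⟨h.1, h.2.map e.trans⟩

/-- The reindexing equivalence of products of cyclic modules. -/
def cycPiCongr (p : Λ) {ι κ : Type*} (σ : ι ≃ κ) (k : ι → ℕ) (k' : κ → ℕ)
    (h : ∀ i, k i = k' (σ i)) : ((i : ι) → Cyc p (k i)) ≃ₗ[Λ] ((j : κ) → Cyc p (k' j)) :=
  (LinearEquiv.piCongrRight fun i =>
    Submodule.quotEquivOfEq _ _ (by rw [h i])).trans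
    (LinearEquiv.piCongrLeft Λ (fun j => Cyc p (k' j)) σ)

theorem subsingleton_cyc_zero (p : Λ) : Subsingleton (Cyc p 0) := by
  refine Ideal.Quotient.subsingleton_iff.2 ?_
  rw [pow_zero, Ideal.span_singleton_one]

/-- Trivial cyclic factors may be dropped from a product. -/
noncomputable def cycPiDropZero (p : Λ) {ι : Type*} (k : ι → ℕ) :
    ((i : ι) → Cyc p (k i)) ≃ₗ[Λ] ((i : {i : ι // k i ≠ 0}) → Cyc p (k i)) := by
  classical
  exact LinearEquiv.ofBijective
    (LinearMap.pi fun i : {i : ι // k i ≠ 0} => LinearMap.proj i.1) <| by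
      constructor
      · intro v w h
        funext i
        by_cases hi : k i = 0
        · have := subsingleton_cyc_zero p
          rw [← hi] at this
          exact Subsingleton.elim _ _
        · exact congrFun h ⟨i, hi⟩
      · intro w
        refine ⟨fun i => if hi : k i ≠ 0 then w ⟨i, hi⟩ else 0, funext fun i => ?_⟩
        simp [i.2]

theorem exists_hasType_pi (p : Λ) {ι : Type*} [Finite ι] (k : ι → ℕ) :
    ∃ l : List ℕ, HasType p ((i : ι) → Cyc p (k i)) l := by
  obtain ⟨d, ⟨σ⟩⟩ := Finite.exists_equiv_fin {i : ι // k i ≠ 0}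
  let k₁ : Fin d → ℕ := fun j => k (σ.symm j).1
  -- `Tuple.sort` sorts increasingly; the reversal makes the list of parts weakly decreasing.
  let τ : Fin d ≃ Fin d := Fin.revPerm.trans (Tuple.sort k₁)
  refine ⟨List.ofFn (k₁ ∘ τ), ⟨?_, ?_⟩, ⟨?_⟩⟩
  · rw [List.pairwise_ofFn]
    intro i j hij
    exact Tuple.monotone_sort k₁ (Fin.rev_le_rev.2 hij.le)
  · intro x hx
    obtain ⟨j, rfl⟩ := (List.mem_ofFn' _ _).1 hx
    exact Nat.pos_of_ne_zero (σ.symm (τ j)).2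
  · refine (cycPiDropZero p k).trans (cycPiCongr p
      (σ.trans (τ.symm.trans (finCongr (List.length_ofFn).symm))) _ _ fun i => ?_)
    simp [k₁]

theorem exists_hasType [IsDomain Λ] [IsPrincipalIdealRing Λ] (p : Λ) (hp : Irreducible p)
    (V : Type*) [AddCommGroup V] [Module Λ V] [Module.Finite Λ V] (k : ℕ)
    (hk : ∀ v : V, p ^ k • v = 0) : ∃ l : List ℕ, HasType p V l := by
  obtain ⟨d, c, ⟨e⟩⟩ := Module.torsion_by_prime_power_decomposition hp
    (M := V) (fun v => ⟨⟨p ^ k, k, rfl⟩, hk v⟩)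
  obtain ⟨l, hl⟩ := exists_hasType_pi p c
  exact ⟨l, hl.of_equiv (e.trans (DirectSum.linearEquivFunOnFintype Λ _ _))⟩

/-- Two submodules have a common tableau if their multiples by powers of `p` vanish simultaneously
and have isomorphic quotients. -/
theorem exists_common_tableau [IsDomain Λ] [IsPrincipalIdealRing Λ] (p : Λ) (hp : Irreducible p)
    {V : Type v} [AddCommGroup V] [Module Λ V] [Module.Finite Λ V] (U U' : Submodule Λ V) (k : ℕ)
    (hk : ∀ v : V, p ^ k • v = 0)
    (hzero : ∀ i : ℕ, Ideal.span {p ^ i} • U = ⊥ ↔ Ideal.span {p ^ i} • U' = ⊥)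
    (hquot : ∀ i : ℕ, Nonempty ((V ⧸ (Ideal.span {p ^ i} • U)) ≃ₗ[Λ]
      (V ⧸ (Ideal.span {p ^ i} • U')))) :
    ∃ Γ : List (List ℕ), HasTableau p U Γ ∧ HasTableau p U' Γ := by
  classical
  have hex : ∃ i : ℕ, Ideal.span {p ^ i} • U = ⊥ := ⟨k, by
    rw [eq_bot_iff, Submodule.ideal_span_singleton_smul]
    rintro _ ⟨x, -, rfl⟩
    exact hk x⟩
  have hT : ∀ i : ℕ, ∃ l, HasType p (V ⧸ (Ideal.span {p ^ i} • U')) l := fun i =>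
    exists_hasType p hp _ k fun v => by
      obtain ⟨v, rfl⟩ := Submodule.Quotient.mk_surjective _ v
      rw [← Submodule.Quotient.mk_smul, hk, Submodule.Quotient.mk_zero]
  choose T hT using hT
  have hleast : IsLeast {j : ℕ | Ideal.span {p ^ j} • U = ⊥} (Nat.find hex) :=
    ⟨Nat.find_spec hex, fun j hj => Nat.find_min' hex hj⟩
  refine ⟨List.ofFn fun i : Fin (Nat.find hex + 1) => T i, ⟨Nat.find hex, hleast, by simp, ?_⟩,
    ⟨Nat.find hex, ?_, by simp, ?_⟩⟩
  · intro i hi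
    obtain ⟨e⟩ := hquot i
    simpa [-List.ofFn_succ] using (hT i).of_equiv e
  · simpa only [hzero] using hleast
  · intro i hi
    simpa [-List.ofFn_succ] using hT i

end Types

/-! ### Shear isomorphisms between quotients of a product -/

section Shear

variable {Λ B D : Type*} [CommRing Λ] [AddCommGroup B] [Module Λ B] [AddCommGroup D] [Module Λ D]

/-- The map `D / (c) → (B × D) / ((a, d), (0, c))`. -/
def pairInr (a : B) (c d : D) :
    (D ⧸ Submodule.span Λ {c}) →ₗ[Λ] ((B × D) ⧸ Submodule.span Λ {(a, d), ((0 : B), c)}) :=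
  Submodule.liftQ _ (Submodule.mkQ _ ∘ₗ LinearMap.inr Λ B D) (by
    rw [Submodule.span_singleton_le_iff_mem, LinearMap.mem_ker, LinearMap.comp_apply,
      Submodule.mkQ_apply, Submodule.Quotient.mk_eq_zero]
    exact Submodule.subset_span (by simp))

/-- The map `(B × D) / ((a, d), (0, c)) → (B × D) / ((a, d'), (0, c))` induced by
`(x, y) ↦ (x, y + h x)`, where `h : B → D / (c)` sends `a` to `d' - d`. -/
def pairShear (a : B) (c d d' : D) (h : B →ₗ[Λ] D ⧸ Submodule.span Λ {c})
    (ha : h a = Submodule.Quotient.mk (d' - d)) :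
    ((B × D) ⧸ Submodule.span Λ {(a, d), ((0 : B), c)}) →ₗ[Λ]
      ((B × D) ⧸ Submodule.span Λ {(a, d'), ((0 : B), c)}) :=
  Submodule.liftQ _ (Submodule.mkQ _ + pairInr a c d' ∘ₗ h ∘ₗ LinearMap.fst Λ B D) (by
    rw [Submodule.span_le, Set.pair_subset_iff]
    constructor
    · rw [SetLike.mem_coe, LinearMap.mem_ker, LinearMap.add_apply, LinearMap.comp_apply,
        LinearMap.comp_apply, LinearMap.fst_apply, ha]
      change Submodule.Quotient.mk (a, d) + Submodule.Quotient.mk ((0 : B), d' - d) = _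
      rw [← Submodule.Quotient.mk_add, Submodule.Quotient.mk_eq_zero]
      exact Submodule.subset_span (by simp)
    · rw [SetLike.mem_coe, LinearMap.mem_ker, LinearMap.add_apply, LinearMap.comp_apply,
        LinearMap.comp_apply, LinearMap.fst_apply, map_zero, map_zero, add_zero,
        Submodule.mkQ_apply, Submodule.Quotient.mk_eq_zero]
      exact Submodule.subset_span (by simp))

theorem pairShear_mk (a : B) (c d d' : D) (h : B →ₗ[Λ] D ⧸ Submodule.span Λ {c})
    (ha : h a = Submodule.Quotient.mk (d' - d)) (x : B × D) :
    pairShear a c d d' h ha (Submodule.Quotient.mk x) =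
      Submodule.Quotient.mk x + pairInr a c d' (h x.1) := rfl

theorem pairShear_pairInr (a : B) (c d d' : D) (h : B →ₗ[Λ] D ⧸ Submodule.span Λ {c})
    (ha : h a = Submodule.Quotient.mk (d' - d)) (y : D ⧸ Submodule.span Λ {c}) :
    pairShear a c d d' h ha (pairInr a c d y) = pairInr a c d' y := by
  obtain ⟨y, rfl⟩ := Submodule.Quotient.mk_surjective _ y
  change Submodule.Quotient.mk ((0 : B), y) + pairInr a c d' (h 0) = Submodule.Quotient.mk (0, y)
  rw [map_zero, map_zero, add_zero]

theorem pairShear_comp (a : B) (c d d' : D) (h h' : B →ₗ[Λ] D ⧸ Submodule.span Λ {c})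
    (ha : h a = Submodule.Quotient.mk (d' - d)) (ha' : h' a = Submodule.Quotient.mk (d - d'))
    (hh : h + h' = 0) :
    pairShear a c d' d h' ha' ∘ₗ pairShear a c d d' h ha = LinearMap.id := by
  refine LinearMap.ext fun y => ?_
  obtain ⟨x, rfl⟩ := Submodule.Quotient.mk_surjective _ y
  rw [LinearMap.comp_apply, pairShear_mk, map_add, pairShear_mk, pairShear_pairInr, add_assoc,
    ← map_add, add_comm (h' x.1), ← LinearMap.add_apply, hh, LinearMap.zero_apply, map_zero,
    add_zero, LinearMap.id_apply]

/-- The shears along $h$ and $-h$ are mutually inverse, because a shear acts as the identity on the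
image of $D$. -/
theorem nonempty_pairQuotient_equiv (a : B) (c d d' : D)
    (h : B →ₗ[Λ] D ⧸ Submodule.span Λ {c}) (ha : h a = Submodule.Quotient.mk (d' - d)) :
    Nonempty (((B × D) ⧸ Submodule.span Λ {(a, d), ((0 : B), c)}) ≃ₗ[Λ]
      ((B × D) ⧸ Submodule.span Λ {(a, d'), ((0 : B), c)})) := by
  have ha' : (-h) a = Submodule.Quotient.mk (d - d') := by
    rw [LinearMap.neg_apply, ha, ← Submodule.Quotient.mk_neg, neg_sub]
  exact ⟨LinearEquiv.ofLinearMap (pairShear a c d d' h ha) (pairShear a c d' d (-h) ha')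
    (pairShear_comp a c d' d _ _ _ _ (neg_add_cancel h))
    (pairShear_comp a c d d' _ _ _ _ (add_neg_cancel h))⟩

theorem Submodule.span_singleton_prod_span_singleton (a : B) (c : D) :
    (Submodule.span Λ {a}).prod (Submodule.span Λ {c}) =
      Submodule.span Λ {(a, (0 : D)), ((0 : B), c)} := by
  apply le_antisymm
  · rintro ⟨x, y⟩ ⟨hx, hy⟩
    obtain ⟨s, rfl⟩ := Submodule.mem_span_singleton.1 hx
    obtain ⟨t, rfl⟩ := Submodule.mem_span_singleton.1 hy
    exact Submodule.mem_span_pair.2 ⟨s, t, by simp⟩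
  · rw [Submodule.span_le, Set.pair_subset_iff]
    exact ⟨⟨Submodule.mem_span_singleton_self a, Submodule.zero_mem _⟩,
      ⟨Submodule.zero_mem _, Submodule.mem_span_singleton_self c⟩⟩

open scoped Pointwise in
theorem Submodule.ideal_span_singleton_smul_span_pair (t : Λ) (x y : B) :
    Ideal.span {t} • Submodule.span Λ {x, y} = Submodule.span Λ {t • x, t • y} := by
  rw [Submodule.ideal_span_singleton_smul, Submodule.smul_span, Set.smul_set_insert,
    Set.smul_set_singleton]

end Shear

/-! ### Heights and index sets of a box move -/

theorem StrictMonoOn.add_sub_le {m : ℕ → ℕ} {N : ℕ} (hm : StrictMonoOn m (Set.Iio N)) {i j : ℕ}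
    (hij : i ≤ j) (hj : j < N) : m i + (j - i) ≤ m j := by
  induction j, hij using Nat.le_induction with
  | base => simp
  | succ j hij ih =>
    have h1 := ih (by omega)
    have h2 := hm (Set.mem_Iio.2 (by omega)) (Set.mem_Iio.2 hj) (Nat.lt_succ_self j)
    omega

namespace BoxMove

variable (X : BoxMove)

theorem idx_val : (X.idx : ℕ) = X.f - 1 := rfl

theorem idx'_val : (X.idx' : ℕ) = X.f' - 1 := rfl

theorem e'_le_f' : X.e' ≤ X.f' := by
  have := X.same_height
  have := X.e_le_f
  omega

theorem m_idx : X.m (X.f - 1) + 1 = X.n := by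
  have := X.col_m X.f X.e_le_f le_rfl
  omega

theorem mt_idx : X.mt (X.f - 1) + 1 = X.n' := by
  have := X.col_mt X.f X.e_le_f le_rfl
  omega

theorem m'_idx : X.m' (X.f' - 1) + 1 = X.n' := by
  have := X.col_m' X.f' X.e'_le_f' le_rfl
  omega

theorem mt'_idx : X.mt' (X.f' - 1) + 1 = X.n := by
  have := X.col_mt' X.f' X.e'_le_f' le_rfl
  omega

theorem lt_of_mem_I {i : ℕ} (hi : i ∈ X.I) : i < X.N := by
  have := X.f_le
  have := X.e_pos
  have := X.e_le_f
  simp only [I, gaps, Finset.mem_insert, Finset.mem_filter, Finset.mem_range] at hi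
  omega

theorem lt_of_mem_I' {i : ℕ} (hi : i ∈ X.I') : i < X.N' := by
  have := X.f_le'
  have := X.e_lt
  have := X.e'_le_f'
  simp only [I', gaps, Finset.mem_insert, Finset.mem_filter, Finset.mem_range] at hi
  omega

/-- Bounds of this kind keep the truncated exponents $m_i - i$ honest. -/
theorem le_mt {i : ℕ} (hi : i ∈ X.I) : i ≤ X.mt i := by
  have := X.strictMono_mt.add_sub_le (Nat.zero_le i) (X.lt_of_mem_I hi)
  omega

theorem le_m' {i : ℕ} (hi : i ∈ X.I') : i ≤ X.m' i := by
  have := X.strictMono_m'.add_sub_le (Nat.zero_le i) (X.lt_of_mem_I' hi)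
  omega

theorem f_le_n' : X.f ≤ X.n' := by
  have := X.le_mt X.idx.2
  rw [idx_val] at this
  have := X.mt_idx
  omega

theorem f'_le_n' : X.f' ≤ X.n' := by
  have := X.le_m' X.idx'.2
  rw [idx'_val] at this
  have := X.m'_idx
  omega

/-- Inside a column the heights are consecutive, so there is no gap at the indices $e-1, \dots,
f-2$. Hence $f-1$ is the only index in $I$ whose height the move changes. -/
theorem outside_of_mem_I {i : ℕ} (hi : i ∈ X.I) (hne : i ≠ X.f - 1) :
    i + 2 ≤ X.e ∨ X.f ≤ i := by
  have hlt := X.lt_of_mem_I hi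
  have := X.f_le
  have := X.e_le_f
  have c1 := X.col_m (i + 1)
  have c2 := X.col_m (i + 1 + 1)
  simp only [Nat.add_sub_cancel] at c1 c2
  simp only [I, gaps, Finset.mem_insert, Finset.mem_filter, Finset.mem_range] at hi
  by_contra!
  have := c1 (by omega) (by omega)
  have := c2 (by omega) (by omega)
  omega

theorem outside_of_mem_I' {i : ℕ} (hi : i ∈ X.I') (hne : i ≠ X.f' - 1) :
    i + 2 ≤ X.e' ∨ X.f' ≤ i := by
  have hlt := X.lt_of_mem_I' hi
  have := X.f_le'
  have := X.e'_le_f'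
  have c1 := X.col_mt' (i + 1)
  have c2 := X.col_mt' (i + 1 + 1)
  simp only [Nat.add_sub_cancel] at c1 c2
  simp only [I', gaps, Finset.mem_insert, Finset.mem_filter, Finset.mem_range] at hi
  by_contra!
  have := c1 (by omega) (by omega)
  have := c2 (by omega) (by omega)
  omega

theorem mt_eq_of_mem {i : ℕ} (hi : i ∈ X.I) (hne : i ≠ X.f - 1) : X.mt i = X.m i := by
  have := X.outside_of_mem_I hi hne
  have := X.e_pos
  have := X.e_le_f
  exact X.mt_eq i (X.lt_of_mem_I hi) (by omega)

theorem mt'_eq_of_mem {i : ℕ} (hi : i ∈ X.I') (hne : i ≠ X.f' - 1) : X.mt' i = X.m' i := by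
  have := X.outside_of_mem_I' hi hne
  have := X.e_lt
  have := X.e'_le_f'
  exact X.mt_eq' i (X.lt_of_mem_I' hi) (by omega)

/-- The sequence $m'$ alone would only give the bound with $n'$. The stronger one holds because the
heights above the column must still increase after it has moved up to $n$ in $\widetilde m'$. -/
theorem le_m'_of_f'_le {i : ℕ} (hi : i ∈ X.I') (hf : X.f' ≤ i) : X.n + i ≤ X.m' i + X.f' := by
  have := X.e_lt
  have := X.e'_le_f'
  have h1 := X.mt'_eq_of_mem hi (by omega)
  have h2 := X.strictMono_mt'.add_sub_le (i := X.f' - 1) (j := i) (by omega) (X.lt_of_mem_I' hi)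
  have h3 := X.mt'_idx
  omega

theorem e_sub_two_mem_I (h : 2 ≤ X.e) : X.e - 2 ∈ X.I := by
  rw [X.I_eq, if_pos h]
  exact Finset.mem_insert_self _ _

/-- The bound with $n'$ instead of $n$ comes from $\widetilde m$, where the column has moved down
while the height at $e-2$ is unchanged. -/
theorem m_e_sub_two (h : 2 ≤ X.e) : X.e - 2 ≤ X.m (X.e - 2) ∧
    X.m (X.e - 2) + X.f ≤ X.n' + (X.e - 2) := by
  have hI := X.e_sub_two_mem_I h
  have := X.e_le_f
  have := X.f_le
  have h1 := X.mt_eq_of_mem hI (by omega)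
  have h2 := X.le_mt hI
  have h3 := X.strictMono_mt.add_sub_le (i := X.e - 2) (j := X.e - 1) (by omega) (by omega)
  have h4 := X.col_mt X.e le_rfl (by omega)
  omega

variable {Λ : Type u} [CommRing Λ]

theorem isShortExact_mono [IsDomain Λ] (p : Λ) (hp : Irreducible p) :
    IsShortExact (X.Rt p) (X.R p) ⊥ (X.mono p) (X.coker p) := by
  refine isShortExact_ambientMap p hp X.mt X.m X.I X.idx (X.n - X.n') ?_
    (fun i hi hne => X.mt_eq_of_mem hi hne) fun i hi => X.le_mt hi
  have := X.m_idx
  have := X.mt_idx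
  have := X.n_lt
  rw [idx_val]
  omega

theorem isShortExact_mono' [IsDomain Λ] (p : Λ) (hp : Irreducible p) :
    IsShortExact (X.R' p) (X.Rt' p) ⊥ (X.mono' p) (X.coker' p) := by
  refine isShortExact_ambientMap p hp X.m' X.mt' X.I' X.idx' (X.n - X.n') ?_
    (fun i hi hne => (X.mt'_eq_of_mem hi hne).symm) fun i hi => X.le_m' hi
  have := X.m'_idx
  have := X.mt'_idx
  have := X.n_lt
  rw [idx'_val]
  omega

end BoxMove

/-! ### Pullbacks of modules along a lift -/

section Pullback

variable {Λ B D D' E : Type*} [CommRing Λ] [AddCommGroup B] [Module Λ B] [AddCommGroup D]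
  [Module Λ D] [AddCommGroup D'] [Module Λ D'] [AddCommGroup E] [Module Λ E]

/-- If `ι` is a kernel of `π'` and `π` factors through `π'` via `σ`, then the pullback of `π` and
`π'` is isomorphic to `B × D`. -/
theorem exists_equiv_eqLocus (ι : D →ₗ[Λ] D') (π' : D' →ₗ[Λ] E) (π : B →ₗ[Λ] E) (σ : B →ₗ[Λ] D')
    (hι : Function.Injective ι) (hex : LinearMap.range ι = LinearMap.ker π') (hσ : π' ∘ₗ σ = π) :
    ∃ φ : (B × D) ≃ₗ[Λ] LinearMap.eqLocus (π ∘ₗ LinearMap.fst Λ B D') (π' ∘ₗ LinearMap.snd Λ B D'),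
      ∀ x, (φ x : B × D') = (x.1, σ x.1 - ι x.2) := by
  have hσ' : ∀ b, π' (σ b) = π b := fun b => LinearMap.congr_fun hσ b
  have hι' : ∀ d, π' (ι d) = 0 := fun d => by
    rw [← LinearMap.mem_ker, ← hex]
    exact LinearMap.mem_range_self ι d
  let ψ : (B × D) →ₗ[Λ] B × D' := (LinearMap.fst Λ B D).prod
    (σ ∘ₗ LinearMap.fst Λ B D - ι ∘ₗ LinearMap.snd Λ B D)
  have hψ : ∀ x, ψ x = (x.1, σ x.1 - ι x.2) := fun x => rfl
  have hmem : ∀ x, ψ x ∈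
      LinearMap.eqLocus (π ∘ₗ LinearMap.fst Λ B D') (π' ∘ₗ LinearMap.snd Λ B D') := fun x => by
    rw [LinearMap.mem_eqLocus, hψ]
    simp [hσ', hι']
  refine ⟨LinearEquiv.ofBijective (ψ.codRestrict _ hmem) ⟨?_, ?_⟩, fun x => rfl⟩
  · rintro ⟨b, d⟩ ⟨b₁, d₁⟩ h
    have h := congrArg Subtype.val h
    simp only [LinearMap.codRestrict_apply, hψ, Prod.mk.injEq] at h
    obtain ⟨rfl, h⟩ := h
    rw [hι (sub_right_injective h)]
  · rintro ⟨⟨b, d'⟩, h⟩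
    rw [LinearMap.mem_eqLocus] at h
    simp only [LinearMap.comp_apply, LinearMap.fst_apply, LinearMap.snd_apply] at h
    have hk : σ b - d' ∈ LinearMap.range ι := by
      rw [hex, LinearMap.mem_ker, map_sub, hσ', h, sub_self]
    obtain ⟨d, hd⟩ := hk
    refine ⟨(b, d), Subtype.ext ?_⟩
    rw [LinearMap.codRestrict_apply, hψ]
    simp [hd]

end Pullback

/-! ### Homomorphisms supported on one generator -/

section AmbientLift

variable {Λ : Type u} [CommRing Λ] {M : Type v} [AddCommGroup M] [Module Λ M]

/-- The map which sends the generator with index `k` to `w` and the other generators to `0`. -/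
def ambientLift (p : Λ) (m : ℕ → ℕ) (I : Finset ℕ) (k : I) (w : M) (hw : p ^ (m k + 1) • w = 0) :
    Ambient p m I →ₗ[Λ] M :=
  cycLift p (m k + 1) w hw ∘ₗ LinearMap.proj k

theorem ambientLift_poleGen (p : Λ) (m : ℕ → ℕ) (I : Finset ℕ) (k : I) (w : M)
    (hw : p ^ (m k + 1) • w = 0) :
    ambientLift p m I k w hw (poleGen p m I) = p ^ (m k - k) • w := by
  rw [ambientLift, LinearMap.comp_apply, LinearMap.proj_apply, poleGen_apply, cycLift_mk]

theorem pow_smul_basisElt (p : Λ) (m : ℕ → ℕ) (I : Finset ℕ) (k : I) (j : ℕ) (hj : m k + 1 ≤ j) :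
    p ^ j • basisElt p m I k = 0 := by
  funext i
  rw [Pi.smul_apply, Pi.zero_apply]
  by_cases h : i = k
  · subst h
    rw [basisElt_apply_self, Cyc.smul_mk, mul_one, Cyc.mk_pow_eq_zero hj]
  · rw [basisElt_apply_of_ne p m I h, smul_zero]

end AmbientLift

/-! ### Isomorphic quotients for $Q$ and $R \oplus R'$ -/

namespace BoxMove

variable (X : BoxMove) {Λ : Type u} [CommRing Λ]

/-- Up to the summands with index `≥ f'`, which are divisible by `p ^ (n - f' + e' - 1)`, the
element `p ^ (e' - 1) c` is a multiple of `d_{n'}`. -/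
theorem exists_pow_smul_poleGen_eq (p : Λ) : ∃ z : Ambient p X.m' X.I',
    p ^ (X.n' - X.f' + (X.e' - 1)) • basisElt p X.m' X.I' X.idx' -
      p ^ (X.n - X.f' + (X.e' - 1)) • z = p ^ (X.e' - 1) • poleGen p X.m' X.I' := by
  -- The coordinates of $z$ are those of $-c$ divided by $p^{n-f'}$, possible for indices $\ge f'$
  -- by `le_m'_of_f'_le`.
  refine ⟨fun y => if X.f' ≤ y then
    -Ideal.Quotient.mk _ (p ^ (X.m' y - y - (X.n - X.f'))) else 0, funext fun y => ?_⟩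
  have hval := X.idx'_val
  have h1 := X.m'_idx
  have h2 := X.e_lt
  have h3 := X.e'_le_f'
  have h4 := X.f'_le_n'
  have h5 := X.n_lt
  have h6 := X.le_m' y.2
  rw [Pi.sub_apply, Pi.smul_apply, Pi.smul_apply, Pi.smul_apply, poleGen_apply, Cyc.smul_mk]
  by_cases h : y = X.idx'
  · subst h
    rw [if_neg (by omega), basisElt_apply_self, smul_zero, sub_zero, Cyc.smul_mk, mul_one,
      ← pow_add]
    congr 2
    rw [hval]
    omega
  · have hne : (y : ℕ) ≠ X.f' - 1 := fun h' => h (Subtype.ext h')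
    rw [basisElt_apply_of_ne p _ _ h, smul_zero, zero_sub]
    -- For $y \le e'-2$ the factor $p^{e'-1}$ raises the exponent $m'_y - y$ to at least $m'_y + 1$,
    -- so the coordinate dies.
    rcases X.outside_of_mem_I' y.2 hne with hy | hy
    · rw [if_neg (by omega), smul_zero, neg_zero, ← pow_add, Cyc.mk_pow_eq_zero (by omega)]
    · have := X.le_m'_of_f'_le y.2 hy
      rw [if_pos hy, smul_neg, neg_neg, Cyc.smul_mk, ← pow_add, ← pow_add]
      congr 2
      omega

/-- Applied with $M = D/(p^i c)$, $\gamma$ the class of $d_{n'}$ and $\zeta$ the class of $z$. The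
condition on $k$ in `hrel` is what makes $p^{e'-1+k} c$ vanish in $M$. -/
theorem exists_lift_pow_smul_poleGen {M : Type v} [AddCommGroup M] [Module Λ M] (p : Λ) (i : ℕ)
    (γ ζ : M) (hγ : p ^ X.n' • γ = 0)
    (hrel : ∀ k, i ≤ X.e' - 1 + k → p ^ (X.n - X.f' + (X.e' - 1) + k) • ζ =
      p ^ (X.n' - X.f' + (X.e' - 1) + k) • γ) :
    ∃ h : Ambient p X.m X.I →ₗ[Λ] M,
      h (p ^ i • poleGen p X.m X.I) = p ^ i • p ^ (X.n' - X.f) • γ := by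
  have h1 := X.m_idx
  have h2 := X.e_lt
  have h3 := X.e'_le_f'
  have h4 := X.f'_le_n'
  have h5 := X.n_lt
  have h6 := X.same_height
  have h7 := X.e_pos
  have h8 := X.e_le_f
  have h9 := X.f_le_n'
  have hval := X.idx_val
  -- For $i \ge f$ the target already contains the factor $p^{n'}$, which kills $\gamma$.
  by_cases hif : X.f ≤ i
  · refine ⟨0, ?_⟩
    rw [LinearMap.zero_apply, ← mul_smul, ← pow_add,
      show i + (X.n' - X.f) = (i - X.f) + X.n' by omega, pow_add, mul_smul, hγ, smul_zero]
  -- This choice of $k$ turns the relation into $p^n \zeta = p^{n'} \gamma = 0$; it is allowed since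
  -- $i < f < f'$. So $b_n \mapsto \zeta$ is well defined.
  have hζ : p ^ (X.m X.idx + 1) • ζ = 0 := by
    have := hrel (X.f' + 1 - X.e') (by omega)
    rwa [show X.n - X.f' + (X.e' - 1) + (X.f' + 1 - X.e') = X.m X.idx + 1 by rw [hval]; omega,
      show X.n' - X.f' + (X.e' - 1) + (X.f' + 1 - X.e') = X.n' by omega, hγ] at this
  have hidx : X.m X.idx - X.idx = X.n - X.f := by rw [hval]; omega
  -- For $e - 1 \le i < f$ the map $b_n \mapsto \zeta$ suffices: since $f - e = f' - e'$, the
  -- relation with $k = i + 1 - e$ reads $p^{i+n-f}\zeta = p^{i+n'-f}\gamma$.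
  by_cases hie : X.e ≤ i + 1
  · refine ⟨ambientLift p X.m X.I X.idx ζ hζ, ?_⟩
    have := hrel (i + 1 - X.e) (by omega)
    rw [map_smul, ambientLift_poleGen, hidx, ← mul_smul, ← mul_smul, ← pow_add, ← pow_add]
    rwa [show X.n - X.f' + (X.e' - 1) + (i + 1 - X.e) = i + (X.n - X.f) by omega,
      show X.n' - X.f' + (X.e' - 1) + (i + 1 - X.e) = i + (X.n' - X.f) by omega] at this
  · have hm := X.m_e_sub_two (by omega)
    let x : X.I := ⟨X.e - 2, X.e_sub_two_mem_I (by omega)⟩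
    have hx : (x : ℕ) = X.e - 2 := rfl
    -- The generator with index $x = e-2$ occurs in $a$ with coefficient $p^{m_x-x}$, so sending it
    -- to $w$ adds exactly the missing $p^{n'-f}\gamma - p^{n-f}\zeta$. Its order is respected
    -- because $p^{m_x+1} w = 0$ is the relation with $k = 0$.
    let w := p ^ (X.n' - X.f - (X.m x - x)) • (γ - p ^ (X.n - X.n') • ζ)
    have hw : p ^ (X.m x + 1) • w = 0 := by
      have := hrel 0 (by omega)
      rw [← mul_smul, ← pow_add, smul_sub, ← mul_smul, ← pow_add, sub_eq_zero, hx]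
      rw [show X.n - X.f' + (X.e' - 1) + 0 =
        X.m (X.e - 2) + 1 + (X.n' - X.f - (X.m (X.e - 2) - (X.e - 2))) + (X.n - X.n') by omega,
        show X.n' - X.f' + (X.e' - 1) + 0 =
        X.m (X.e - 2) + 1 + (X.n' - X.f - (X.m (X.e - 2) - (X.e - 2))) by omega] at this
      exact this.symm
    refine ⟨ambientLift p X.m X.I X.idx ζ hζ + ambientLift p X.m X.I x w hw, ?_⟩
    rw [map_smul, LinearMap.add_apply, ambientLift_poleGen, ambientLift_poleGen, hidx, ← mul_smul,
      ← pow_add, show X.m x - x + (X.n' - X.f - (X.m x - x)) = X.n' - X.f by rw [hx]; omega,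
      smul_sub, ← mul_smul _ _ ζ, ← pow_add,
      show X.n' - X.f + (X.n - X.n') = X.n - X.f by omega, add_sub_cancel]

theorem nonempty_quotient_equiv (p : Λ) (i : ℕ) :
    Nonempty (((Ambient p X.m X.I × Ambient p X.m' X.I') ⧸ (Ideal.span {p ^ i} • X.Q p)) ≃ₗ[Λ]
      ((Ambient p X.m X.I × Ambient p X.m' X.I') ⧸
        (Ideal.span {p ^ i} • (X.R p).prod (X.R' p)))) := by
  obtain ⟨z, hz⟩ := X.exists_pow_smul_poleGen_eq p
  obtain ⟨h, hh⟩ := X.exists_lift_pow_smul_poleGen p i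
    (M := Ambient p X.m' X.I' ⧸ Submodule.span Λ {p ^ i • poleGen p X.m' X.I'})
    (Submodule.Quotient.mk (basisElt p X.m' X.I' X.idx')) (Submodule.Quotient.mk z)
    (by
      rw [← Submodule.Quotient.mk_smul, pow_smul_basisElt p _ _ _ _ X.m'_idx.le,
        Submodule.Quotient.mk_zero])
    (fun k hk => by
      rw [← Submodule.Quotient.mk_smul, ← Submodule.Quotient.mk_smul, eq_comm,
        Submodule.Quotient.eq, add_comm _ k, add_comm _ k, pow_add, pow_add p k, mul_smul,
        mul_smul, ← smul_sub, hz, ← mul_smul, ← pow_add, add_comm k,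
        ← Nat.sub_add_cancel hk, pow_add, mul_smul]
      exact Submodule.smul_mem _ _ (Submodule.mem_span_singleton_self _))
  obtain ⟨e⟩ := nonempty_pairQuotient_equiv (p ^ i • poleGen p X.m X.I)
    (p ^ i • poleGen p X.m' X.I') 0
    (p ^ i • p ^ (X.n' - X.f) • basisElt p X.m' X.I' X.idx') h (by rw [hh, sub_zero]; rfl)
  rw [Q, R, R', pole, pole, Submodule.span_singleton_prod_span_singleton,
    Submodule.ideal_span_singleton_smul_span_pair, Submodule.ideal_span_singleton_smul_span_pair,
    r, s, Prod.smul_mk, Prod.smul_mk, Prod.smul_mk, smul_zero, smul_zero]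
  exact ⟨e.symm⟩

/-- If $p^i a = 0$, the coordinate with index $f-1$ forces $i \ge f$, and then the extra component
$p^{i+n'-f} d_{n'}$ vanishes too. -/
theorem smul_Q_eq_bot_iff [IsDomain Λ] (p : Λ) (hp : Irreducible p) (i : ℕ) :
    Ideal.span {p ^ i} • X.Q p = ⊥ ↔ Ideal.span {p ^ i} • (X.R p).prod (X.R' p) = ⊥ := by
  rw [Q, R, R', pole, pole, Submodule.span_singleton_prod_span_singleton,
    Submodule.ideal_span_singleton_smul_span_pair, Submodule.ideal_span_singleton_smul_span_pair,
    r, s, Prod.smul_mk, Prod.smul_mk, Prod.smul_mk, Submodule.span_eq_bot, Submodule.span_eq_bot]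
  simp only [Set.mem_insert_iff, Set.mem_singleton_iff, forall_eq_or_imp, forall_eq, smul_zero,
    Prod.mk_eq_zero, true_and, and_true]
  refine and_congr_left fun _ => and_iff_left_of_imp fun h => ?_
  have h0 := congrFun h X.idx
  rw [Pi.smul_apply, poleGen_apply, Cyc.smul_mk, ← pow_add, Pi.zero_apply,
    Cyc.mk_pow_eq_zero_iff hp, idx_val] at h0
  have h1 := X.m_idx
  have h2 := X.f_le_n'
  have h3 := X.e_pos
  have h4 := X.e_le_f
  have h5 := X.n_lt
  rw [← mul_smul, ← pow_add]
  refine pow_smul_basisElt p _ _ _ _ ?_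
  rw [idx'_val, X.m'_idx]
  omega

/-! ### Identification of $Q$ with the pullback -/

/-- The map `B → D~`, `b_n ↦ d~_n`, and `b_i ↦ 0` otherwise. -/
def overlap (p : Λ) : Ambient p X.m X.I →ₗ[Λ] Ambient p X.mt' X.I' :=
  LinearMap.single Λ (fun i : X.I' => Cyc p (X.mt' i + 1)) X.idx' ∘ₗ
    cycMap p (X.m X.idx + 1) (X.mt' X.idx' + 1) ∘ₗ LinearMap.proj X.idx

theorem overlap_apply_idx' (p : Λ) (b : Ambient p X.m X.I) :
    X.overlap p b X.idx' = cycMap p (X.m X.idx + 1) (X.mt' X.idx' + 1) (b X.idx) :=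
  Pi.single_eq_same _ _

theorem overlap_apply_of_ne (p : Λ) (b : Ambient p X.m X.I) {y : X.I'} (h : y ≠ X.idx') :
    X.overlap p b y = 0 :=
  Pi.single_eq_of_ne h _

theorem coker'_comp_overlap (p : Λ) : X.coker' p ∘ₗ X.overlap p = X.coker p := by
  have h1 := X.m_idx
  have h2 := X.mt'_idx
  refine LinearMap.ext fun b => ?_
  obtain ⟨t, ht⟩ := Ideal.Quotient.mk_surjective (b X.idx)
  rw [coker', coker, LinearMap.comp_apply, LinearMap.comp_apply, LinearMap.comp_apply,
    LinearMap.proj_apply, LinearMap.proj_apply, overlap_apply_idx', ← ht, cycMap_mk, cycMap_mk,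
    cycMap_mk, ← mul_assoc, ← pow_add]
  congr 3
  rw [idx_val, idx'_val]
  omega

/-- Both sides are $p^{n-f}\widetilde d_n$; this explains the exponent $n' - f$ in `r`. -/
theorem overlap_poleGen (p : Λ) : X.overlap p (poleGen p X.m X.I) =
    X.mono' p (p ^ (X.n' - X.f) • basisElt p X.m' X.I' X.idx') := by
  have h1 := X.m_idx
  have h2 := X.mt'_idx
  have h3 := X.m'_idx
  have h4 := X.n_lt
  have h5 := X.f_le_n'
  have h6 := X.e_pos
  have h7 := X.e_le_f
  funext y
  rw [map_smul, Pi.smul_apply, mono', ambientMap_apply]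
  by_cases h : y = X.idx'
  · subst h
    rw [overlap_apply_idx', poleGen_apply, basisElt_apply_self, cycMap_mk, cycMap_mk,
      Cyc.smul_mk, mul_one, ← pow_add, ← pow_add]
    congr 2
    rw [idx_val, idx'_val]
    omega
  · rw [basisElt_apply_of_ne p _ _ h, map_zero, smul_zero, X.overlap_apply_of_ne p _ h]

theorem mono'_poleGen (p : Λ) : X.mono' p (poleGen p X.m' X.I') = poleGen p X.mt' X.I' := by
  have h2 := X.mt'_idx
  have h3 := X.m'_idx
  have h4 := X.n_lt
  refine ambientMap_poleGen p _ _ _ fun i hi => ⟨X.le_m' hi, ?_⟩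
  by_cases h : i = X.f' - 1
  · rw [h]; omega
  · exact (X.mt'_eq_of_mem hi h).ge

theorem mem_pullbackEmb (p : Λ) (y : X.pullbackAmbient p) :
    y ∈ X.pullbackEmb p ↔ y.1.1 ∈ X.R p ∧ y.1.2 ∈ X.Rt' p := Iff.rfl

theorem exists_pullback_equiv [IsDomain Λ] (p : Λ) (hp : Irreducible p) :
    ∃ φ : (Ambient p X.m X.I × Ambient p X.m' X.I') ≃ₗ[Λ] X.pullbackAmbient p,
      (X.Q p).map φ.toLinearMap = X.pullbackEmb p := by
  have hS := X.isShortExact_mono' p hp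
  obtain ⟨φ, hφ⟩ : ∃ φ : (Ambient p X.m X.I × Ambient p X.m' X.I') ≃ₗ[Λ] X.pullbackAmbient p,
      ∀ x, (φ x).1 = (x.1, X.overlap p x.1 - X.mono' p x.2) :=
    exists_equiv_eqLocus (X.mono' p) (X.coker' p) (X.coker p) (X.overlap p)
      hS.injective hS.exact (X.coker'_comp_overlap p)
  have hr : (φ (X.r p)).1 = (poleGen p X.m X.I, 0) := by
    rw [hφ, r, overlap_poleGen, sub_self]
  have hs : (φ (X.s p)).1 = (0, -poleGen p X.mt' X.I') := by
    rw [hφ, s, map_zero, zero_sub, mono'_poleGen]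
  refine ⟨φ, le_antisymm ?_ ?_⟩
  · rw [Q, Submodule.map_span_le]
    intro x hx
    rw [mem_pullbackEmb, LinearEquiv.coe_coe]
    rcases hx with rfl | rfl
    · rw [hr]
      exact ⟨Submodule.mem_span_singleton_self _, Submodule.zero_mem _⟩
    · rw [hs]
      exact ⟨Submodule.zero_mem _, Submodule.neg_mem _ (Submodule.mem_span_singleton_self _)⟩
  · intro y hy
    rw [mem_pullbackEmb] at hy
    obtain ⟨t, ht⟩ := Submodule.mem_span_singleton.1 hy.1
    obtain ⟨u, hu⟩ := Submodule.mem_span_singleton.1 hy.2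
    -- The coefficient $-u$ compensates the sign in the image $(0, -\widetilde c)$ of $s$.
    refine Submodule.mem_map.2 ⟨t • X.r p + (-u) • X.s p, Submodule.mem_span_pair.2 ⟨t, -u, rfl⟩,
      Subtype.ext ?_⟩
    rw [LinearEquiv.coe_coe, map_add, map_smul, map_smul, Submodule.coe_add, Submodule.coe_smul,
      Submodule.coe_smul, hr, hs, Prod.smul_mk, Prod.smul_mk, Prod.mk_add_mk, smul_zero, smul_zero,
      add_zero, zero_add, neg_smul, smul_neg, neg_neg, ht, hu]

end BoxMove

theorem mainTheorem12 {Λ : Type u} [CommRing Λ] [IsDomain Λ] [IsDiscreteValuationRing Λ]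
    (p : Λ) (hp : Irreducible p) (X : BoxMove) :
    -- the two monomorphisms, with their cokernel maps onto `E_{(n-n')}`
    IsShortExact (X.Rt p) (X.R p) ⊥ (X.mono p) (X.coker p) ∧
    IsShortExact (X.R' p) (X.Rt' p) ⊥ (X.mono' p) (X.coker' p) ∧
    -- `Q` is the pullback of the two cokernel maps
    (∃ φ : (Ambient p X.m X.I × Ambient p X.m' X.I') ≃ₗ[Λ] X.pullbackAmbient p,
      (X.Q p).map φ.toLinearMap = X.pullbackEmb p) ∧
    -- `Q` and `R ⊕ R'` have the same tableau
    (∃ Γ : List (List ℕ), HasTableau p (X.Q p) Γ ∧ HasTableau p ((X.R p).prod (X.R' p)) Γ) := by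
  refine ⟨X.isShortExact_mono p hp, X.isShortExact_mono' p hp, X.exists_pullback_equiv p hp, ?_⟩
  obtain ⟨k, hk⟩ := Ambient.exists_pow_smul_eq_zero p X.m X.I
  obtain ⟨k', hk'⟩ := Ambient.exists_pow_smul_eq_zero p X.m' X.I'
  refine exists_common_tableau p hp (X.Q p) _ (k + k') (fun v => ?_) (X.smul_Q_eq_bot_iff p hp)
    (X.nonempty_quotient_equiv p)
  refine Prod.ext ?_ ?_
  · rw [Prod.smul_fst, add_comm, pow_add, mul_smul, hk, smul_zero, Prod.fst_zero]
  · rw [Prod.smul_snd, pow_add, mul_smul, hk', smul_zero, Prod.snd_zero]
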